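/- A convex disk is a compact convex subset of $\mathbb{R}^2$ with non-empty interior, and $|S|$ denotes the area of $S\subset\mathbb{R}^2$. A packing with copies of a convex disk $K$ is a family $\mathcal F$ of sets congruent to $K$ (images of $K$ under isometries of the plane, reflections included) whose interiors are mutually disjoint; its density is $$d(\mathcal F)=\limsup_{r\to\infty}\frac{1}{|B_r|}\sum_{A\in\mathcal F}|A\cap B_r|,$$ where $B_r$ is the disk of radius $r$ centered at the origin. Let $\delta(K)$ be the supremum of $d(\mathcal F)$ over all packings $\mathcal F$ with copies of $K$, let $\delta_T(K)$ be the supremum over all such packings consisting of translates of $K$, and let $\delta_L(K)$ be the supremum over all lattice packings $\{K+x : x\in L\}$, where $L$ is a lattice of rank $2$ in $\mathbb{R}^2$. **Proposition 4.** Let $C$ be a closed circular disk of positive radius, let $H$ be a regular hexagon circumscribed about $C$ (that is, $C\subset H$ and every side of $H$ touches $C$), and let $K$ be a convex disk sandwiched between $C$ and $H$, that is, $C\subset K\subset H$. Then $$\delta(K)=\frac{|K|}{|H|}\qquad\text{and}\qquad \delta(K)=\delta_T(K)=\delta_L(K).$$ -/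

import Mathlib

open MeasureTheory Filter
open scoped ENNReal Pointwise

noncomputable section

/-- A convex body in `ℝⁿ`: a compact convex set that contains an interior point.
For `n = 2` this is a convex disk. -/
structure IsConvexBody {n : ℕ} (K : Set (EuclideanSpace ℝ (Fin n))) : Prop where
  isCompact : IsCompact K
  convex : Convex ℝ K
  interior_nonempty : (interior K).Nonempty

/-- `F` is a packing with congruent copies of `K`: each member of `F` is the image of `K` under an
isometry of `ℝⁿ` (reflections included), and distinct members have disjoint interiors. -/
structure IsPacking {n : ℕ} (K : Set (EuclideanSpace ℝ (Fin n)))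
    (F : Set (Set (EuclideanSpace ℝ (Fin n)))) : Prop where
  congruent : ∀ A ∈ F, ∃ g : EuclideanSpace ℝ (Fin n) ≃ᵢ EuclideanSpace ℝ (Fin n), A = g '' K
  disjoint_interior : F.PairwiseDisjoint interior

/-- Every member of `F` is a translate of `K`. -/
def IsTranslative {n : ℕ} (K : Set (EuclideanSpace ℝ (Fin n)))
    (F : Set (Set (EuclideanSpace ℝ (Fin n)))) : Prop :=
  ∀ A ∈ F, ∃ x : EuclideanSpace ℝ (Fin n), A = x +ᵥ K

/-- `F` consists of all the translates of `K` by the vectors of some lattice of full rank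
in `ℝⁿ`. -/
def IsLatticeArrangement {n : ℕ} (K : Set (EuclideanSpace ℝ (Fin n)))
    (F : Set (Set (EuclideanSpace ℝ (Fin n)))) : Prop :=
  ∃ (L : Submodule ℤ (EuclideanSpace ℝ (Fin n))) (_ : DiscreteTopology L),
    IsZLattice ℝ L ∧ F = {A | ∃ x ∈ L, A = x +ᵥ K}

/-- The upper density of a family `F` of sets: the upper limit, as `r → ∞`, of the sum of the
volumes of the sets `A ∩ B_r`, `A ∈ F`, divided by the volume of `B_r`, where `B_r` is the ball of
radius `r` centered at the origin. -/
def familyDensity {n : ℕ} (F : Set (Set (EuclideanSpace ℝ (Fin n)))) : ℝ≥0∞ :=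
  limsup (fun r : ℝ =>
    (∑' A : F, volume ((A : Set (EuclideanSpace ℝ (Fin n))) ∩ Metric.closedBall 0 r)) /
      volume (Metric.closedBall (0 : EuclideanSpace ℝ (Fin n)) r)) atTop

/-- The packing density `δ(K)`. -/
def packingDensity {n : ℕ} (K : Set (EuclideanSpace ℝ (Fin n))) : ℝ≥0∞ :=
  sSup {d | ∃ F, IsPacking K F ∧ d = familyDensity F}

/-- The translative packing density `δ_T(K)`. -/
def translativePackingDensity {n : ℕ} (K : Set (EuclideanSpace ℝ (Fin n))) : ℝ≥0∞ :=
  sSup {d | ∃ F, IsPacking K F ∧ IsTranslative K F ∧ d = familyDensity F}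

/-- The lattice packing density `δ_L(K)`. -/
def latticePackingDensity {n : ℕ} (K : Set (EuclideanSpace ℝ (Fin n))) : ℝ≥0∞ :=
  sSup {d | ∃ F, IsPacking K F ∧ IsLatticeArrangement K F ∧ d = familyDensity F}

/-- `B` is sandwiched between `A` and `C`. -/
def SandwichedBetween {X : Type*} (B A C : Set X) : Prop :=
  (A ⊆ B ∧ B ⊆ C) ∨ (C ⊆ B ∧ B ⊆ A)

/-- `v 0, …, v 5` are the consecutive vertices of a (non-degenerate) regular hexagon in the
plane: they lie at equal angles on a circle with center `o` and radius `R > 0`. -/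
def IsRegularHexagon (v : Fin 6 → EuclideanSpace ℝ (Fin 2)) : Prop :=
  ∃ (o : EuclideanSpace ℝ (Fin 2)) (R θ : ℝ), 0 < R ∧ ∀ k : Fin 6,
    v k = o + R • !₂[Real.cos (θ + (k : ℕ) * (Real.pi / 3)),
                     Real.sin (θ + (k : ℕ) * (Real.pi / 3))]

/-- The convex hexagon with consecutive vertices `v 0, …, v 5` is circumscribed about `C`:
it contains `C`, and each of its six sides touches `C`. -/
def IsCircumscribedAbout (v : Fin 6 → EuclideanSpace ℝ (Fin 2))
    (C : Set (EuclideanSpace ℝ (Fin 2))) : Prop :=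
  C ⊆ convexHull ℝ (Set.range v) ∧ ∀ k : Fin 6, (segment ℝ (v k) (v (k + 1)) ∩ C).Nonempty

end

open scoped RealInnerProductSpace

/-! Both bounds compare `K` with the hexagon `H` of circumradius `R`, whose area is 3√3/2 · R².
Upper bound: every copy of `K` contains a disk whose radius is the apothem √3/2 · R, so the disk
centres are at least √3 R apart. Truncate the Voronoi cell of each centre at radius ρ = R. A
neighbour cuts a circular segment off the truncating disk. The sectors over the cutting chords are
disjoint (`disjoint_sectors`), and each segment fills at most the proportion 1 - 3√3/(2π) of its
sector (`volume_complex_segment_le`). Here 3√3/(2π) is the ratio of the inscribed regular hexagon to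
its disk, so every cell keeps at least the area of `H` (`le_volume_truncated_voronoi_cell`).
Counting cells in a large ball gives `packingDensity_le`. Lower bound: translates of `H` by the
hexagonal lattice do not overlap, and the fundamental domain has the area of `H`. Since `K` lies in
`H`, its translates form a lattice packing of density at least |K|/|H|. The inequalities δ_L ≤ δ_T ≤
δ close the circle. -/

/-! ### Areas of circular sectors, triangles and segments. -/

theorem volume_complex_sector {h ρ : ℝ} (hh : 0 < h) (hρ : h < ρ) :
    volume {y : ℂ | ‖y‖ < ρ ∧ h * ‖y‖ < ρ * y.re} =
      ENNReal.ofReal (ρ ^ 2 * Real.arccos (h / ρ)) := by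
  have hρ0 : 0 < ρ := hh.trans hρ
  set φ := Real.arccos (h / ρ) with hφ
  have hφ0 : 0 ≤ φ := Real.arccos_nonneg _
  have hφπ : φ < Real.pi := by
    refine lt_of_lt_of_le (Real.arccos_lt_pi_div_two.2 (by positivity)) (by linarith [Real.pi_pos])
  have hcos : Real.cos φ = h / ρ :=
    Real.cos_arccos (by linarith [div_pos hh hρ0]) ((div_le_one hρ0).2 hρ.le)
  have hmeas : MeasurableSet {y : ℂ | ‖y‖ < ρ ∧ h * ‖y‖ < ρ * y.re} := by
    exact ((isOpen_lt (by fun_prop) (by fun_prop)).and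
      (isOpen_lt (by fun_prop) (by fun_prop))).measurableSet
  rw [← lintegral_indicator_one hmeas, ← Complex.lintegral_comp_polarCoord_symm]
  have hset : ∀ p ∈ polarCoord.target,
      ENNReal.ofReal p.1 • ({y : ℂ | ‖y‖ < ρ ∧ h * ‖y‖ < ρ * y.re}.indicator 1
        (Complex.polarCoord.symm p) : ℝ≥0∞) =
      (Set.Ioo 0 ρ).indicator (fun s => ENNReal.ofReal s) p.1 *
        (Set.Ioo (-φ) φ).indicator 1 p.2 := by
    rintro ⟨s, θ⟩ hp
    simp only [polarCoord_target, Set.mem_prod, Set.mem_Ioi, Set.mem_Ioo] at hp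
    obtain ⟨hs, hθ1, hθ2⟩ := hp
    have hn : ‖Complex.polarCoord.symm (s, θ)‖ = s := by
      rw [Complex.norm_polarCoord_symm, abs_of_pos hs]
    have hr : (Complex.polarCoord.symm (s, θ)).re = s * Real.cos θ := by
      simp [Complex.polarCoord_symm_apply, -Complex.ofReal_cos, -Complex.ofReal_sin]
    have key : h * s < ρ * (s * Real.cos θ) ↔ -φ < θ ∧ θ < φ := by
      rw [← abs_lt, ← Real.strictAntiOn_cos.lt_iff_gt ⟨hφ0, hφπ.le⟩
        ⟨abs_nonneg θ, (abs_lt.2 ⟨hθ1, hθ2⟩).le⟩, Real.cos_abs, hcos, div_lt_iff₀ hρ0]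
      constructor <;> intro H <;> nlinarith
    simp only [Set.indicator, Set.mem_ofPred_eq, hn, hr, key, Set.mem_Ioo, hs, true_and]
    by_cases h1 : s < ρ <;> by_cases h2 : -φ < θ ∧ θ < φ <;> simp [h1, h2]
  rw [setLIntegral_congr_fun polarCoord.open_target.measurableSet hset]
  -- The product is supported in the polar chart, so the integral extends to all of ℝ × ℝ and splits
  -- into a radial and an angular factor.
  have hsub : ∀ p : ℝ × ℝ, p ∉ polarCoord.target →
      (Set.Ioo 0 ρ).indicator (fun s => ENNReal.ofReal s) p.1 *
        (Set.Ioo (-φ) φ).indicator 1 p.2 = 0 := by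
    rintro ⟨s, θ⟩ hp
    simp only [polarCoord_target, Set.mem_prod, Set.mem_Ioi, Set.mem_Ioo] at hp
    by_contra hne
    rw [← ne_eq, mul_ne_zero_iff] at hne
    have h1 : s ∈ Set.Ioo 0 ρ := Set.mem_of_indicator_ne_zero hne.1
    have h2 : θ ∈ Set.Ioo (-φ) φ := Set.mem_of_indicator_ne_zero hne.2
    exact hp ⟨h1.1, by linarith [h2.1], by linarith [h2.2]⟩
  rw [setLIntegral_eq_of_support_subset]
  · rw [Measure.volume_eq_prod, lintegral_prod_mul]
    · rw [lintegral_indicator measurableSet_Ioo, lintegral_indicator_one measurableSet_Ioo,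
        Real.volume_Ioo, ← ofReal_integral_eq_lintegral_ofReal,
        ← integral_Ioc_eq_integral_Ioo, ← intervalIntegral.integral_of_le hρ0.le, integral_id,
        ← ENNReal.ofReal_mul (by simp; positivity)]
      · congr 1; ring
      · exact (continuous_id.integrableOn_Icc).mono_set Set.Ioo_subset_Icc_self
      · exact (ae_restrict_mem measurableSet_Ioo).mono fun x hx => hx.1.le
    · exact (ENNReal.measurable_ofReal.indicator measurableSet_Ioo).aemeasurable
    · exact (measurable_one.indicator measurableSet_Ioo).aemeasurable
  · intro p hp
    by_contra hn
    exact hp (hsub p hn)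

theorem volume_complex_triangle {h t : ℝ} (hh : 0 < h) (ht : 0 ≤ t) :
    volume {y : ℂ | 0 < y.re ∧ y.re < h ∧ h * |y.im| < t * y.re} = ENNReal.ofReal (h * t) := by
  have hset : {y : ℂ | 0 < y.re ∧ y.re < h ∧ h * |y.im| < t * y.re} =
      Complex.measurableEquivRealProd ⁻¹'
        regionBetween (-fun x => t / h * x) (fun x => t / h * x) (Set.Ioo 0 h) := by
    ext y
    simp only [Set.mem_ofPred_eq, regionBetween, Set.mem_preimage, Set.mem_Ioo, Pi.neg_apply,
      Complex.measurableEquivRealProd_apply, ← abs_lt]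
    rw [div_mul_eq_mul_div, lt_div_iff₀ hh, mul_comm h, and_assoc]
  have hint : IntegrableOn (fun x => t / h * x) (Set.Ioo 0 h) :=
    ((continuous_const.mul continuous_id).integrableOn_Icc).mono_set Set.Ioo_subset_Icc_self
  rw [hset, Complex.volume_preserving_equiv_real_prod.measure_preimage_equiv,
    Measure.volume_eq_prod,
    volume_regionBetween_eq_integral hint.neg hint measurableSet_Ioo]
  · congr 1
    rw [← integral_Ioc_eq_integral_Ioo, ← intervalIntegral.integral_of_le hh.le]
    simp only [Pi.sub_apply, Pi.neg_apply, sub_neg_eq_add, ← two_mul]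
    rw [intervalIntegral.integral_const_mul, intervalIntegral.integral_const_mul, integral_id]
    field_simp
    ring
  · intro x hx
    have := hx.1
    have : 0 ≤ t / h * x := by positivity
    simp only [Pi.neg_apply]
    linarith

/-- Concavity puts sin(2φ) above its chord over [0, π/3]. Equality at φ = π/6 is the case of the
regular hexagon. -/
theorem three_sqrt_three_mul_le_mul_sin_mul_cos {φ : ℝ} (h0 : 0 ≤ φ) (h1 : φ ≤ Real.pi / 6) :
    3 * √3 / (2 * Real.pi) * φ ≤ Real.sin φ * Real.cos φ := by
  have hπ := Real.pi_pos
  have h2 : (0 : ℝ) ≤ 1 - 6 * φ / Real.pi := by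
    rw [sub_nonneg, div_le_one hπ]; linarith
  have h3 : (0 : ℝ) ≤ 6 * φ / Real.pi := by positivity
  have h4 : (0 : ℝ) ∈ Set.Icc 0 Real.pi := ⟨le_rfl, hπ.le⟩
  have h5 : Real.pi / 3 ∈ Set.Icc 0 Real.pi := ⟨by positivity, by linarith⟩
  have hc := strictConcaveOn_sin_Icc.concaveOn.2 h4 h5 h2 h3 (by ring)
  simp only [smul_eq_mul, mul_zero, Real.sin_zero, zero_add, Real.sin_pi_div_three] at hc
  rw [show 6 * φ / Real.pi * (Real.pi / 3) = 2 * φ by field_simp; ring, Real.sin_two_mul] at hc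
  have : 3 * √3 / (2 * Real.pi) * φ = (6 * φ / Real.pi * (√3 / 2)) / 2 := by field_simp; ring
  rw [this]; linarith

/-- The circular segment cut from a disk by a chord at distance `h` from the centre occupies at
most a fixed proportion of the circular sector over that chord. -/
theorem volume_complex_segment_le {h ρ : ℝ} (hh : 0 < h) (hρ : √3 * ρ ≤ 2 * h) :
    volume.real {y : ℂ | ‖y‖ < ρ ∧ h ≤ y.re} ≤
      (1 - 3 * √3 / (2 * Real.pi)) *
        volume.real {y : ℂ | ‖y‖ < ρ ∧ h * ‖y‖ < ρ * y.re} := by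
  rcases le_or_gt ρ h with hle | hlt
  · have h1 : {y : ℂ | ‖y‖ < ρ ∧ h ≤ y.re} = ∅ := by
      ext y
      simp only [Set.mem_ofPred_eq, Set.mem_empty_iff_false, iff_false, not_and, not_le]
      intro hy
      exact (Complex.re_le_norm y).trans_lt (hy.trans_le hle)
    rw [h1, measureReal_empty]
    refine mul_nonneg ?_ measureReal_nonneg
    have hπ := Real.pi_gt_three
    rw [sub_nonneg, div_le_one (by positivity)]
    have : √3 ≤ 2 := Real.sqrt_le_iff.2 ⟨by norm_num, by norm_num⟩
    linarith
  have hρ0 : 0 < ρ := hh.trans hlt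
  set φ := Real.arccos (h / ρ) with hφ
  set t := √(ρ ^ 2 - h ^ 2) with ht
  have ht0 : 0 ≤ t := Real.sqrt_nonneg _
  have ht2 : t ^ 2 = ρ ^ 2 - h ^ 2 := Real.sq_sqrt (by nlinarith)
  have hcos : Real.cos φ = h / ρ :=
    Real.cos_arccos (by linarith [div_pos hh hρ0]) ((div_le_one hρ0).2 hlt.le)
  have hsin : Real.sin φ = t / ρ := by
    rw [hφ, Real.sin_arccos, ht, show 1 - (h / ρ) ^ 2 = (ρ ^ 2 - h ^ 2) / ρ ^ 2 by field_simp,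
      Real.sqrt_div' _ (by positivity), Real.sqrt_sq hρ0.le]
  -- The half-angle bound is the separation hypothesis √3 ρ ≤ 2h read through the cosine.
  have hφ6 : φ ≤ Real.pi / 6 := by
    rw [hφ, show Real.pi / 6 = Real.arccos (√3 / 2) by
      rw [← Real.cos_pi_div_six, Real.arccos_cos] <;> linarith [Real.pi_pos]]
    refine Real.arccos_le_arccos ?_
    rw [div_le_div_iff₀ two_pos hρ0]; linarith
  have hT := volume_complex_triangle hh ht0
  have hS := volume_complex_sector hh hlt
  rw [← hφ] at hS
  have key := three_sqrt_three_mul_le_mul_sin_mul_cos (Real.arccos_nonneg _) hφ6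
  rw [hsin, hcos] at key
  -- The chord splits the sector `S` into the triangle `T` and the segment `G`; only |G| + |T| ≤ |S|
  -- is needed.
  set S := {y : ℂ | ‖y‖ < ρ ∧ h * ‖y‖ < ρ * y.re}
  set T := {y : ℂ | 0 < y.re ∧ y.re < h ∧ h * |y.im| < t * y.re}
  set G := {y : ℂ | ‖y‖ < ρ ∧ h ≤ y.re}
  have hTS : T ⊆ S := by
    rintro y ⟨h1, h2, h3⟩
    have hn : ‖y‖ ^ 2 = y.re ^ 2 + y.im ^ 2 := by
      rw [Complex.sq_norm, Complex.normSq_apply]; ring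
    have h4 : (h * |y.im|) ^ 2 < (t * y.re) ^ 2 :=
      pow_lt_pow_left₀ h3 (by positivity) two_ne_zero
    rw [mul_pow, mul_pow, sq_abs, ht2] at h4
    have h5 : h * ‖y‖ < ρ * y.re := by
      refine lt_of_pow_lt_pow_left₀ 2 (by positivity) ?_
      rw [mul_pow, mul_pow, hn]; linarith
    refine ⟨?_, h5⟩
    have : h * ‖y‖ < h * ρ := h5.trans (by nlinarith)
    exact lt_of_mul_lt_mul_left this hh.le
  have hGS : G ⊆ S := by
    rintro y ⟨h1, h2⟩
    exact ⟨h1, by nlinarith⟩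
  have hdis : Disjoint G T :=
    Set.disjoint_left.2 fun y hy hy' => absurd hy.2 (not_le.2 hy'.2.1)
  have hTm : MeasurableSet T := by
    exact ((isOpen_lt (by fun_prop) (by fun_prop)).and
      ((isOpen_lt (by fun_prop) (by fun_prop)).and
      (isOpen_lt (by fun_prop) (by fun_prop)))).measurableSet
  have hSr : volume.real S = ρ ^ 2 * φ := by
    rw [measureReal_def, hS, ENNReal.toReal_ofReal (by positivity [Real.arccos_nonneg (h / ρ)])]
  have hTr : volume.real T = h * t := by
    rw [measureReal_def, hT, ENNReal.toReal_ofReal (by positivity)]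
  have hSf : volume S ≠ ∞ := by rw [hS]; exact ENNReal.ofReal_ne_top
  have hGf : volume G ≠ ∞ := ne_top_of_le_ne_top hSf (measure_mono hGS)
  have hTf : volume T ≠ ∞ := ne_top_of_le_ne_top hSf (measure_mono hTS)
  have hsum : volume.real G + volume.real T ≤ volume.real S := by
    rw [← measureReal_union hdis hTm hGf hTf]
    exact measureReal_mono (Set.union_subset hGS hTS) hSf
  have h6 : 3 * √3 / (2 * Real.pi) * φ * ρ ^ 2 ≤ h * t := by
    calc _ ≤ t / ρ * (h / ρ) * ρ ^ 2 := by gcongr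
      _ = h * t := by field_simp
  rw [hSr, hTr] at hsum
  rw [hSr]
  linarith

/-! ### Truncated Voronoi cells and Thue's theorem. -/

theorem exists_linearIsometryEquiv_complex_apply_eq_norm {u : EuclideanSpace ℝ (Fin 2)}
    (hu : u ≠ 0) : ∃ Φ : EuclideanSpace ℝ (Fin 2) ≃ₗᵢ[ℝ] ℂ, Φ u = (‖u‖ : ℂ) := by
  set Φ := Complex.orthonormalBasisOneI.repr.symm
  have hn : ‖Φ u‖ = ‖u‖ := Φ.norm_map u
  have hz : Φ u ≠ 0 := by simpa using hu
  refine ⟨Φ.trans (rotation ⟨(‖u‖ : ℂ) / Φ u, ?_⟩), ?_⟩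
  · simp [Submonoid.unitSphere, hn, hu]
  · change (‖u‖ : ℂ) / Φ u * Φ u = _
    exact div_mul_cancel₀ _ hz

/-- The segment lies beyond the perpendicular bisector of 0 and `u`. An isometry taking `u` to the
positive real axis reduces to the complex case with h = ‖u‖/2. -/
theorem volume_segment_le {u : EuclideanSpace ℝ (Fin 2)} {ρ : ℝ} (hu : u ≠ 0)
    (hρ : √3 * ρ ≤ ‖u‖) :
    volume.real {y : EuclideanSpace ℝ (Fin 2) | ‖y‖ < ρ ∧ ‖u‖ ^ 2 ≤ 2 * ⟪y, u⟫} ≤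
      (1 - 3 * √3 / (2 * Real.pi)) *
        volume.real {y : EuclideanSpace ℝ (Fin 2) | ‖y‖ < ρ ∧ ‖u‖ ^ 2 * ‖y‖ < 2 * ρ * ⟪y, u⟫} := by
  obtain ⟨Φ, hΦ⟩ := exists_linearIsometryEquiv_complex_apply_eq_norm hu
  have hu0 : 0 < ‖u‖ := norm_pos_iff.2 hu
  have hin (y) : ⟪y, u⟫ = ‖u‖ * (Φ y).re := by
    rw [← Φ.inner_map_map, hΦ, Complex.inner]
    simp
  have key := volume_complex_segment_le (h := ‖u‖ / 2) (ρ := ρ) (by positivity) (by linarith)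
  have e1 : {y : EuclideanSpace ℝ (Fin 2) | ‖y‖ < ρ ∧ ‖u‖ ^ 2 ≤ 2 * ⟪y, u⟫} =
      Φ.toMeasurableEquiv ⁻¹' {y : ℂ | ‖y‖ < ρ ∧ ‖u‖ / 2 ≤ y.re} := by
    ext y
    have : ‖u‖ ^ 2 ≤ 2 * (‖u‖ * (Φ y).re) ↔ ‖u‖ / 2 ≤ (Φ y).re := by
      constructor <;> intro h <;> nlinarith
    simp [hin, this]
  have e2 : {y : EuclideanSpace ℝ (Fin 2) | ‖y‖ < ρ ∧ ‖u‖ ^ 2 * ‖y‖ < 2 * ρ * ⟪y, u⟫} =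
      Φ.toMeasurableEquiv ⁻¹' {y : ℂ | ‖y‖ < ρ ∧ ‖u‖ / 2 * ‖y‖ < ρ * y.re} := by
    ext y
    have : ‖u‖ ^ 2 * ‖y‖ < 2 * ρ * (‖u‖ * (Φ y).re) ↔ ‖u‖ / 2 * ‖y‖ < ρ * (Φ y).re := by
      constructor <;> intro h <;> nlinarith
    simp [hin, this]
  have hm : MeasurePreserving Φ.toMeasurableEquiv volume volume := Φ.measurePreserving
  rwa [e1, e2, measureReal_def, measureReal_def, hm.measure_preimage_equiv,
    hm.measure_preimage_equiv, ← measureReal_def, ← measureReal_def]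

/-- A common point, pushed out radially to `z` with ‖z‖ = ρ, would be closer than ρ to both `u` and
`w`. The squared pairwise distances of 0, `u`, `w` sum to at most three times the sum of their
squared distances to `z`, which is less than 9ρ². Separation makes that sum at least 9ρ². -/
theorem disjoint_sectors {E : Type*} [NormedAddCommGroup E] [InnerProductSpace ℝ E] {u w : E}
    {ρ : ℝ} (hρ : 0 < ρ) (hu : √3 * ρ ≤ ‖u‖) (hw : √3 * ρ ≤ ‖w‖) (huw : √3 * ρ ≤ ‖u - w‖) :
    Disjoint {y : E | ‖y‖ < ρ ∧ ‖u‖ ^ 2 * ‖y‖ < 2 * ρ * ⟪y, u⟫}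
      {y : E | ‖y‖ < ρ ∧ ‖w‖ ^ 2 * ‖y‖ < 2 * ρ * ⟪y, w⟫} := by
  rw [Set.disjoint_left]
  rintro y ⟨-, h1⟩ ⟨-, h2⟩
  rcases eq_or_ne y 0 with rfl | hy
  · simp at h1
  have hs : 0 < ‖y‖ := norm_pos_iff.2 hy
  have sq (x : E) (hx : √3 * ρ ≤ ‖x‖) : 3 * ρ ^ 2 ≤ ‖x‖ ^ 2 := by
    have := pow_le_pow_left₀ (by positivity) hx 2
    rwa [mul_pow, Real.sq_sqrt (by norm_num)] at this
  set z := (ρ / ‖y‖) • y with hz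
  have hzn : ‖z‖ = ρ := by
    rw [hz, norm_smul, Real.norm_of_nonneg (by positivity)]; field_simp
  have hzu : ‖u‖ ^ 2 < 2 * ⟪z, u⟫ := by
    rw [hz, real_inner_smul_left, div_mul_eq_mul_div, ← mul_div_assoc, lt_div_iff₀ hs]; linarith
  have hzw : ‖w‖ ^ 2 < 2 * ⟪z, w⟫ := by
    rw [hz, real_inner_smul_left, div_mul_eq_mul_div, ← mul_div_assoc, lt_div_iff₀ hs]; linarith
  -- Nonnegativity of this square is the inequality between pairwise distances and distances to `z`.
  have e1 : ‖(3 : ℝ) • z - (u + w)‖ ^ 2 =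
      9 * ρ ^ 2 - 6 * (⟪z, u⟫ + ⟪z, w⟫) + (‖u‖ ^ 2 + 2 * ⟪u, w⟫ + ‖w‖ ^ 2) := by
    clear_value z
    rw [norm_sub_sq_real, norm_add_sq_real, norm_smul, hzn, inner_add_right,
      real_inner_smul_left, real_inner_smul_left]
    norm_num; ring
  have e2 := norm_sub_sq_real u w
  have := sq _ hu
  have := sq _ hw
  have := sq _ huw
  nlinarith [sq_nonneg ‖(3 : ℝ) • z - (u + w)‖]

/-- The truncated Voronoi cell of the origin with respect to a separated finite set is at least as
large as the regular hexagon inscribed in the truncating circle. -/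
theorem le_volume_truncated_voronoi_cell {U : Finset (EuclideanSpace ℝ (Fin 2))} {ρ : ℝ}
    (hρ : 0 < ρ) (hU : ∀ u ∈ U, √3 * ρ ≤ ‖u‖)
    (hsep : (U : Set (EuclideanSpace ℝ (Fin 2))).Pairwise fun u w => √3 * ρ ≤ ‖u - w‖) :
    3 * √3 / 2 * ρ ^ 2 ≤
      volume.real {y : EuclideanSpace ℝ (Fin 2) | ‖y‖ < ρ ∧ ∀ u ∈ U, ‖y‖ < ‖y - u‖} := by
  set W := {y : EuclideanSpace ℝ (Fin 2) | ‖y‖ < ρ ∧ ∀ u ∈ U, ‖y‖ < ‖y - u‖}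
  let G (u : EuclideanSpace ℝ (Fin 2)) :=
    {y : EuclideanSpace ℝ (Fin 2) | ‖y‖ < ρ ∧ ‖u‖ ^ 2 ≤ 2 * ⟪y, u⟫}
  let S (u : EuclideanSpace ℝ (Fin 2)) :=
    {y : EuclideanSpace ℝ (Fin 2) | ‖y‖ < ρ ∧ ‖u‖ ^ 2 * ‖y‖ < 2 * ρ * ⟪y, u⟫}
  set D := Metric.ball (0 : EuclideanSpace ℝ (Fin 2)) ρ
  have hDf : volume D ≠ ∞ := measure_ball_lt_top.ne
  have hD : volume.real D = Real.pi * ρ ^ 2 := by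
    rw [measureReal_def, EuclideanSpace.volume_ball_fin_two]
    simp [hρ.le, Real.pi_pos.le, mul_comm]
  have hSD : ∀ u, S u ⊆ D := fun u y hy => by simpa [D] using hy.1
  have hWD : W ⊆ D := fun y hy => by simpa [D] using hy.1
  have hcov : D ⊆ W ∪ ⋃ u ∈ U, G u := by
    intro y hy
    have hy' : ‖y‖ < ρ := by simpa [D] using hy
    by_cases h : ∀ u ∈ U, ‖y‖ < ‖y - u‖
    · exact Or.inl ⟨hy', h⟩
    · push Not at h
      obtain ⟨u, hu, hle⟩ := h
      refine Or.inr (Set.mem_biUnion hu ⟨hy', ?_⟩)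
      have h2 := pow_le_pow_left₀ (norm_nonneg _) hle 2
      rw [norm_sub_sq_real] at h2
      linarith
  have hSmeas : ∀ u, MeasurableSet (S u) := fun u =>
    ((isOpen_lt (by fun_prop) (by fun_prop)).and
      (isOpen_lt (by fun_prop) (by fun_prop))).measurableSet
  -- The segments may overlap, but the sectors are disjoint inside the disk, so the proportional
  -- bound sums to the same proportion of the whole disk.
  have hGle : ∑ u ∈ U, volume.real (G u) ≤ (1 - 3 * √3 / (2 * Real.pi)) * (Real.pi * ρ ^ 2) := by
    calc ∑ u ∈ U, volume.real (G u)
        ≤ ∑ u ∈ U, (1 - 3 * √3 / (2 * Real.pi)) * volume.real (S u) := by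
          refine Finset.sum_le_sum fun u hu => volume_segment_le ?_ (hU u hu)
          rintro rfl
          have := hU 0 hu
          rw [norm_zero] at this
          exact absurd this (not_le.2 (by positivity))
      _ = (1 - 3 * √3 / (2 * Real.pi)) * volume.real (⋃ u ∈ U, S u) := by
          rw [← Finset.mul_sum, measureReal_biUnion_finset _ _
            fun u _ => ne_top_of_le_ne_top hDf (measure_mono (hSD u))]
          · exact fun u hu w hw huw =>
              disjoint_sectors hρ (hU u hu) (hU w hw) (hsep hu hw huw)
          · exact fun u _ => hSmeas u
      _ ≤ (1 - 3 * √3 / (2 * Real.pi)) * volume.real D := by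
          refine mul_le_mul_of_nonneg_left
            (measureReal_mono (Set.iUnion₂_subset fun u _ => hSD u) hDf) ?_
          have hπ := Real.pi_gt_three
          rw [sub_nonneg, div_le_one (by positivity)]
          have : √3 ≤ 2 := Real.sqrt_le_iff.2 ⟨by norm_num, by norm_num⟩
          linarith
      _ = _ := by rw [hD]
  have hle : volume.real D ≤ volume.real W + ∑ u ∈ U, volume.real (G u) := by
    have hf : volume (W ∪ ⋃ u ∈ U, G u) ≠ ∞ := by
      refine ne_top_of_le_ne_top hDf (measure_mono (Set.union_subset hWD ?_))
      exact Set.iUnion₂_subset fun u _ y hy => by simpa [D] using hy.1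
    calc volume.real D ≤ volume.real (W ∪ ⋃ u ∈ U, G u) := measureReal_mono hcov hf
      _ ≤ volume.real W + volume.real (⋃ u ∈ U, G u) := measureReal_union_le _ _
      _ ≤ _ := by gcongr; exact measureReal_biUnion_finset_le _ _
  have : (1 - 3 * √3 / (2 * Real.pi)) * (Real.pi * ρ ^ 2) =
      Real.pi * ρ ^ 2 - 3 * √3 / 2 * ρ ^ 2 := by
    field_simp
  linarith

/-- Thue's theorem for a finite family of points in a bounded region. -/
theorem card_mul_hexagon_area_le {P : Finset (EuclideanSpace ℝ (Fin 2))} {ρ T : ℝ} (hρ : 0 < ρ)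
    (hsep : (P : Set (EuclideanSpace ℝ (Fin 2))).Pairwise fun p q => √3 * ρ ≤ dist p q)
    (hP : ∀ p ∈ P, ‖p‖ ≤ T) :
    (P.card : ℝ≥0∞) * ENNReal.ofReal (3 * √3 / 2 * ρ ^ 2) ≤
      volume (Metric.closedBall (0 : EuclideanSpace ℝ (Fin 2)) (T + ρ)) := by
  classical
  -- Strict inequalities make the cells disjoint; truncation keeps them within ρ of their centres.
  let V (p : EuclideanSpace ℝ (Fin 2)) :=
    {x | dist x p < ρ ∧ ∀ q ∈ P, q ≠ p → dist x p < dist x q}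
  have hV : ∀ p ∈ P, ENNReal.ofReal (3 * √3 / 2 * ρ ^ 2) ≤ volume (V p) := by
    intro p hp
    let U := (P.erase p).image fun q => q - p
    have hcell := le_volume_truncated_voronoi_cell (U := U) hρ
      (by
        intro u hu
        obtain ⟨q, hq, rfl⟩ := Finset.mem_image.1 hu
        rw [← dist_eq_norm]
        exact hsep (Finset.mem_of_mem_erase hq) hp (Finset.ne_of_mem_erase hq))
      (by
        intro u hu w hw huw
        obtain ⟨q, hq, rfl⟩ := Finset.mem_image.1 (Finset.mem_coe.1 hu)
        obtain ⟨q', hq', rfl⟩ := Finset.mem_image.1 (Finset.mem_coe.1 hw)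
        have := hsep (Finset.mem_of_mem_erase hq) (Finset.mem_of_mem_erase hq')
          (fun h => huw (by simp [h]))
        simpa [dist_eq_norm] using this)
    refine (ENNReal.ofReal_le_of_le_toReal hcell).trans_eq ?_
    rw [← measure_preimage_add_right volume (-p)]
    congr 1
    ext x
    simp only [V, U, Set.mem_preimage, Set.mem_ofPred_eq, Finset.mem_image, Finset.mem_erase,
      forall_exists_index, and_imp, dist_eq_norm, ← sub_eq_add_neg]
    refine and_congr_right fun _ => ⟨fun h q hq hne => ?_, fun h u q hne hq hu => ?_⟩
    · simpa using h _ q hne hq rfl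
    · subst hu
      simpa using h q hq hne
  have hVo : ∀ p, MeasurableSet (V p) := by
    intro p
    have : V p = {x | dist x p < ρ} ∩ ⋂ q ∈ P, {x | q ≠ p → dist x p < dist x q} := by
      ext x; simp [V]
    rw [this]
    refine (isOpen_lt (by fun_prop) (by fun_prop)).measurableSet.inter
      (Finset.measurableSet_biInter _ fun q _ => ?_)
    by_cases h : q = p
    · simp [h]
    · simpa [h] using
        (isOpen_lt (f := fun x => dist x p) (g := fun x => dist x q)
          (by fun_prop) (by fun_prop)).measurableSet
  calc (P.card : ℝ≥0∞) * ENNReal.ofReal (3 * √3 / 2 * ρ ^ 2)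
      = ∑ p ∈ P, ENNReal.ofReal (3 * √3 / 2 * ρ ^ 2) := by simp
    _ ≤ ∑ p ∈ P, volume (V p) := Finset.sum_le_sum hV
    _ = volume (⋃ p ∈ P, V p) := by
        refine (measure_biUnion_finset (fun p hp q hq hpq => ?_) fun p _ => hVo p).symm
        exact Set.disjoint_left.2 fun x hx hx' =>
          lt_asymm (hx.2 q hq hpq.symm) (hx'.2 p hp hpq)
    _ ≤ _ := by
        refine measure_mono (Set.iUnion₂_subset fun p hp x hx => ?_)
        rw [mem_closedBall_zero_iff]
        have h1 := hx.1
        rw [dist_eq_norm] at h1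
        have h2 := norm_add_le (x - p) p
        rw [sub_add_cancel] at h2
        linarith [hP p hp]

/-! ### Upper bound for the packing density. -/

/-- By Mazur–Ulam the isometry is affine, hence a linear isometry followed by a translation. -/
theorem IsometryEquiv.volume_image {n : ℕ}
    (g : EuclideanSpace ℝ (Fin n) ≃ᵢ EuclideanSpace ℝ (Fin n))
    (K : Set (EuclideanSpace ℝ (Fin n))) : volume (g '' K) = volume K := by
  let L := g.toRealAffineIsometryEquiv.linearIsometryEquiv
  have hg : ∀ x, g x = g 0 +ᵥ L x := by
    intro x
    have := g.toRealAffineIsometryEquiv.map_vadd 0 x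
    simp only [vadd_eq_add, add_zero] at this
    rw [vadd_eq_add, add_comm]
    exact this
  have : g '' K = g 0 +ᵥ L '' K := by
    rw [← Set.image_vadd, Set.image_image]
    exact Set.image_congr fun x _ => hg x
  rw [this, measure_vadd]
  exact L.toMeasurableEquiv.image_eq_preimage_symm K ▸
    (L.symm.measurePreserving.measure_preimage_equiv (f := L.symm.toMeasurableEquiv) K)

theorem tendsto_volume_closedBall_div_volume_closedBall (D : ℝ) :
    Tendsto (fun R : ℝ => volume (Metric.closedBall (0 : EuclideanSpace ℝ (Fin 2)) (R + D)) /
      volume (Metric.closedBall (0 : EuclideanSpace ℝ (Fin 2)) R)) atTop (nhds 1) := by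
  have h1 : Tendsto (fun R : ℝ => ENNReal.ofReal ((1 + D / R) ^ 2)) atTop (nhds 1) := by
    have h2 : Tendsto (fun R : ℝ => (1 + D / R) ^ 2) atTop (nhds ((1 + 0) ^ 2)) :=
      (tendsto_const_nhds.add (tendsto_const_nhds.div_atTop tendsto_id)).pow 2
    simpa using ENNReal.tendsto_ofReal h2
  refine h1.congr' ?_
  filter_upwards [eventually_gt_atTop 0, eventually_ge_atTop (-D)] with R hR hR'
  have hRD : 0 ≤ R + D := by linarith
  rw [EuclideanSpace.volume_closedBall_fin_two, EuclideanSpace.volume_closedBall_fin_two,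
    ENNReal.mul_div_mul_right, ← ENNReal.ofReal_pow hRD, ← ENNReal.ofReal_pow hR.le,
    ← ENNReal.ofReal_div_of_pos (by positivity)]
  · congr 1; field_simp
  · simp [Real.pi_pos]
  · simp

/-- Non-overlapping copies have disjoint inner disks, so Thue's count applies to the images of `c`.
A copy meeting the ball of radius R has its centre within R + D, and the collar of width D + ρ is
negligible in the limit. -/
theorem packingDensity_le {K : Set (EuclideanSpace ℝ (Fin 2))} {c : EuclideanSpace ℝ (Fin 2)}
    {r ρ : ℝ} (hρ0 : 0 < ρ) (hρ : √3 * ρ = 2 * r) (hc : Metric.closedBall c r ⊆ K)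
    (hK : Bornology.IsBounded K) :
    packingDensity K ≤ volume K / ENNReal.ofReal (3 * √3 / 2 * ρ ^ 2) := by
  classical
  have hr : 0 < r := by
    have : 0 < √3 * ρ := by positivity
    linarith
  set a := ENNReal.ofReal (3 * √3 / 2 * ρ ^ 2) with ha
  have ha0 : a ≠ 0 := by rw [ha, ne_eq, ENNReal.ofReal_eq_zero, not_le]; positivity
  have hat : a ≠ ∞ := ENNReal.ofReal_ne_top
  obtain ⟨D, hD⟩ := hK.subset_closedBall c
  refine sSup_le ?_
  rintro _ ⟨F, hF, rfl⟩
  choose! g hg using hF.congruent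
  have hdist : ∀ A ∈ F, ∀ B ∈ F, A ≠ B → 2 * r ≤ dist (g A c) (g B c) := by
    intro A hA B hB hAB
    have hsub : ∀ A ∈ F, Metric.ball (g A c) r ⊆ interior A := by
      intro A hA
      refine interior_maximal ?_ Metric.isOpen_ball
      conv_rhs => rw [hg A hA]
      rw [← IsometryEquiv.image_ball]
      exact Set.image_mono (Metric.ball_subset_closedBall.trans hc)
    have hd : Disjoint (Metric.ball (g A c) r) (Metric.ball (g B c) r) :=
      (hF.disjoint_interior hA hB hAB).mono (hsub A hA) (hsub B hB)
    have := (disjoint_ball_ball_iff hr hr).1 hd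
    linarith
  have hinj : Set.InjOn (fun A => g A c) F := by
    intro A hA B hB hAB
    by_contra hne
    have := hdist A hA B hB hne
    simp only at hAB
    rw [hAB, dist_self] at this
    linarith
  have hbound : ∀ R : ℝ,
      (∑' A : F, volume ((A : Set (EuclideanSpace ℝ (Fin 2))) ∩ Metric.closedBall 0 R)) ≤
        volume K / a * volume (Metric.closedBall (0 : EuclideanSpace ℝ (Fin 2)) (R + (D + ρ))) := by
    intro R
    rw [ENNReal.tsum_eq_iSup_sum]
    refine iSup_le fun s => ?_
    let s' := s.filter fun A : F =>
      ((A : Set (EuclideanSpace ℝ (Fin 2))) ∩ Metric.closedBall 0 R).Nonempty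
    let P := s'.image fun A : F => g A c
    have hcard : P.card = s'.card := by
      refine Finset.card_image_of_injOn fun A _ B _ hAB => ?_
      exact Subtype.ext (hinj A.2 B.2 hAB)
    have hthue := card_mul_hexagon_area_le (P := P) (T := R + D) hρ0
      (by
        intro p hp q hq hpq
        obtain ⟨A, hA, rfl⟩ := Finset.mem_image.1 (Finset.mem_coe.1 hp)
        obtain ⟨B, hB, rfl⟩ := Finset.mem_image.1 (Finset.mem_coe.1 hq)
        rw [hρ]
        exact hdist A A.2 B B.2 fun h => hpq (by simp only [h]))
      (by
        intro p hp
        obtain ⟨A, hA, rfl⟩ := Finset.mem_image.1 hp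
        obtain ⟨x, hxA, hxR⟩ := (Finset.mem_filter.1 hA).2
        rw [hg A A.2] at hxA
        obtain ⟨y, hy, rfl⟩ := hxA
        have h1 : dist (g A c) (g A y) ≤ D := by
          rw [(g A).dist_eq, dist_comm]
          exact hD hy
        rw [mem_closedBall_zero_iff] at hxR
        have h2 := norm_add_le (g A c - g A y) (g A y)
        rw [sub_add_cancel, ← dist_eq_norm] at h2
        linarith)
    calc ∑ A ∈ s, volume ((A : Set (EuclideanSpace ℝ (Fin 2))) ∩ Metric.closedBall 0 R)
        = ∑ A ∈ s', volume ((A : Set (EuclideanSpace ℝ (Fin 2))) ∩ Metric.closedBall 0 R) := by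
          refine (Finset.sum_filter_of_ne fun A _ hA => ?_).symm
          by_contra h
          rw [Set.not_nonempty_iff_eq_empty.1 h] at hA
          exact hA measure_empty
      _ ≤ ∑ A ∈ s', volume K := by
          refine Finset.sum_le_sum fun A _ => (measure_mono Set.inter_subset_left).trans_eq ?_
          conv_lhs => rw [hg A A.2]
          exact IsometryEquiv.volume_image _ _
      _ = P.card * volume K := by simp [hcard]
      _ = volume K / a * (P.card * a) := by
          rw [mul_left_comm, ENNReal.div_mul_cancel ha0 hat]
      _ ≤ _ := by
          rw [← add_assoc]
          gcongr
  have hlim : Tendsto (fun R : ℝ => volume K / a *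
      (volume (Metric.closedBall (0 : EuclideanSpace ℝ (Fin 2)) (R + (D + ρ))) /
      volume (Metric.closedBall (0 : EuclideanSpace ℝ (Fin 2)) R))) atTop
      (nhds (volume K / a * 1)) :=
    ENNReal.Tendsto.const_mul (tendsto_volume_closedBall_div_volume_closedBall _)
      (Or.inl one_ne_zero)
  rw [mul_one] at hlim
  rw [familyDensity, ← hlim.limsup_eq]
  refine limsup_le_limsup (Eventually.of_forall fun R => ?_)
  simp only [← mul_div_assoc]
  gcongr
  exact hbound R

/-! ### Coordinates, area and apothem of the regular hexagon. -/

/-- The vertices, in cyclic order, of the regular hexagon inscribed in the unit circle which has a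
vertex at `1`. -/
noncomputable def unitHexagonVertex : Fin 6 → ℂ :=
  ![⟨1, 0⟩, ⟨1 / 2, √3 / 2⟩, ⟨-1 / 2, √3 / 2⟩, ⟨-1, 0⟩, ⟨-1 / 2, -(√3 / 2)⟩, ⟨1 / 2, -(√3 / 2)⟩]

/-- The regular hexagon with centre `0`, circumradius `R` and a vertex at `R`. -/
def hexagon (R : ℝ) : Set ℂ :=
  {z | 2 * |z.im| ≤ √3 * R ∧ √3 * |z.re| + |z.im| ≤ √3 * R}

theorem sqrt_three_mul_self : √3 * √3 = 3 := Real.mul_self_sqrt (by norm_num)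

theorem convex_hexagon (R : ℝ) : Convex ℝ (hexagon R) := by
  have h1 : ConvexOn ℝ Set.univ fun z : ℂ => |z.im| := by
    refine ⟨convex_univ, fun x _ y _ a b ha hb _ => ?_⟩
    simp only [Complex.add_im, Complex.smul_im, smul_eq_mul]
    refine (abs_add_le _ _).trans_eq ?_
    rw [abs_mul, abs_mul, abs_of_nonneg ha, abs_of_nonneg hb]
  have h2 : ConvexOn ℝ Set.univ fun z : ℂ => |z.re| := by
    refine ⟨convex_univ, fun x _ y _ a b ha hb _ => ?_⟩
    simp only [Complex.add_re, Complex.smul_re, smul_eq_mul]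
    refine (abs_add_le _ _).trans_eq ?_
    rw [abs_mul, abs_mul, abs_of_nonneg ha, abs_of_nonneg hb]
  have h3 := (h1.smul (zero_le_two (α := ℝ))).convex_le (√3 * R)
  have h4 := ((h2.smul (Real.sqrt_nonneg 3)).add h1).convex_le (√3 * R)
  have : hexagon R = {x : ℂ | x ∈ Set.univ ∧ (2 : ℝ) • |x.im| ≤ √3 * R} ∩
      {x : ℂ | x ∈ Set.univ ∧ ((fun x : ℂ => √3 • |x.re|) + fun z : ℂ => |z.im|) x ≤ √3 * R} := by
    ext z
    simp [hexagon]
  rw [this]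
  exact h3.inter h4

theorem convexHull_range_unitHexagonVertex {R : ℝ} (hR : 0 < R) :
    convexHull ℝ (Set.range fun k => R • unitHexagonVertex k) = hexagon R := by
  have h3 : 0 < √3 := by positivity
  have h33 := sqrt_three_mul_self
  apply Set.Subset.antisymm
  · refine convexHull_min ?_ (convex_hexagon R)
    rintro _ ⟨k, rfl⟩
    have e1 : |√3| = √3 := abs_of_pos h3
    have e2 : |R| = R := abs_of_pos hR
    have e3 : |(-1 : ℝ) / 2| = 1 / 2 := by norm_num
    fin_cases k <;> simp [hexagon, unitHexagonVertex, abs_mul, abs_div, e1, e2, e3] <;>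
      (try constructor) <;> nlinarith
  · set C := convexHull ℝ (Set.range fun k => R • unitHexagonVertex k)
    have hC : Convex ℝ C := convex_convexHull ℝ _
    have hv : ∀ k, R • unitHexagonVertex k ∈ C := fun k => subset_convexHull ℝ _ ⟨k, rfl⟩
    -- a point at height `y` between two horizontal chords through vertices
    have hmid : ∀ {a b c d : ℂ}, a ∈ C → b ∈ C → c ∈ C → d ∈ C → ∀ z ∈ hexagon R,
        ∀ ε : ℝ, ε * ε = 1 → 0 ≤ ε * z.im →
        a = ⟨R, 0⟩ → b = ⟨-R, 0⟩ → c = ⟨R / 2, ε * (√3 / 2 * R)⟩ →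
        d = ⟨-(R / 2), ε * (√3 / 2 * R)⟩ → z ∈ C := by
      rintro _ _ _ _ ha hb hc hd z ⟨hz1, hz2⟩ ε hε hεz rfl rfl rfl rfl
      have habs : |z.im| = ε * z.im := by
        rw [← abs_of_nonneg hεz, abs_mul]
        have : |ε| = 1 := by
          have := congrArg abs hε
          rw [abs_mul, abs_one] at this
          nlinarith [abs_nonneg ε]
        rw [this, one_mul]
      rw [habs] at hz1 hz2
      set y := ε * z.im with hy
      have hzy : z.im = ε * y := by rw [hy, ← mul_assoc, hε, one_mul]
      -- `t` is the height of `z` relative to the top (or bottom) side. Interpolating by `t` along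
      -- the two slanted sides gives the ends ±`m` of the horizontal chord through `z`.
      set t := 2 * y / (√3 * R) with ht
      have ht0 : 0 ≤ t := by positivity
      have ht1 : t ≤ 1 := (div_le_one (by positivity)).2 hz1
      have hty : t * (√3 / 2 * R) = y := by rw [ht]; field_simp
      have hp := hC ha hc (sub_nonneg.2 ht1) ht0 (by ring)
      have hq := hC hb hd (sub_nonneg.2 ht1) ht0 (by ring)
      set m := R - t * (R / 2) with hm
      have hm0 : 0 < m := by nlinarith
      have hxm : |z.re| ≤ m := by
        have : √3 * |z.re| ≤ √3 * m := by rw [hm]; nlinarith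
        exact le_of_mul_le_mul_left this h3
      obtain ⟨hx1, hx2⟩ := abs_le.1 hxm
      obtain ⟨α, β, hα, hβ, hαβ, hαβm⟩ :
          ∃ α β : ℝ, 0 ≤ α ∧ 0 ≤ β ∧ α + β = 1 ∧ (α - β) * m = z.re :=
        ⟨(m + z.re) / (2 * m), (m - z.re) / (2 * m), div_nonneg (by linarith) (by linarith),
          div_nonneg (by linarith) (by linarith), by field_simp; ring, by field_simp; ring⟩
      have := hC hp hq hα hβ hαβ
      convert this using 1
      apply Complex.ext
      · simp only [Complex.add_re, Complex.smul_re, smul_eq_mul]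
        rw [← hαβm, hm]
        ring
      · simp only [Complex.add_im, Complex.smul_im, smul_eq_mul]
        rw [hzy, ← hty]
        linear_combination (-(t * (ε * (√3 / 2 * R)))) * hαβ
    intro z hz
    rcases le_total 0 z.im with him | him
    · refine hmid (hv 0) (hv 3) (hv 1) (hv 2) z hz 1 (by norm_num) (by simpa using him) ?_ ?_ ?_ ?_
      all_goals apply Complex.ext <;> simp [unitHexagonVertex] <;> ring
    · refine hmid (hv 0) (hv 3) (hv 5) (hv 4) z hz (-1) (by norm_num) (by linarith) ?_ ?_ ?_ ?_
      all_goals apply Complex.ext <;> simp [unitHexagonVertex] <;> ring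

/-- Fubini over horizontal slices: the slice at height y has length 2(R - |y|/√3). -/
theorem volume_hexagon {R : ℝ} (hR : 0 < R) :
    volume (hexagon R) = ENNReal.ofReal (3 * √3 / 2 * R ^ 2) := by
  have h3 : 0 < √3 := by positivity
  have h33 := sqrt_three_mul_self
  set m := √3 / 2 * R with hm
  have hm0 : 0 < m := by positivity
  let s : Set (ℝ × ℝ) := {p | 2 * |p.2| ≤ √3 * R ∧ √3 * |p.1| + |p.2| ≤ √3 * R}
  have hs : MeasurableSet s :=
    ((isClosed_le (by fun_prop) (by fun_prop)).and
      (isClosed_le (by fun_prop) (by fun_prop))).measurableSet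
  have hset : hexagon R = Complex.measurableEquivRealProd ⁻¹' s := rfl
  rw [hset, Complex.volume_preserving_equiv_real_prod.measure_preimage_equiv,
    Measure.volume_eq_prod, Measure.prod_apply_symm hs]
  have hslice : ∀ y : ℝ, volume ((fun x => (x, y)) ⁻¹' s) =
      (Set.Icc (-m) m).indicator (fun y => ENNReal.ofReal (2 * (R - |y| / √3))) y := by
    intro y
    by_cases hy : y ∈ Set.Icc (-m) m
    · have hy' : 2 * |y| ≤ √3 * R := by have := abs_le.2 hy; linarith
      rw [Set.indicator_of_mem hy]
      have : (fun x => (x, y)) ⁻¹' s = Set.Icc (-(R - |y| / √3)) (R - |y| / √3) := by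
        ext x
        simp only [s, Set.mem_preimage, Set.mem_ofPred_eq, hy', true_and, Set.mem_Icc, ← abs_le]
        have e : |y| = √3 * (|y| / √3) := by field_simp
        rw [le_sub_iff_add_le]
        conv_lhs => rw [e]
        rw [← mul_add, mul_le_mul_iff_right₀ h3]
      rw [this, Real.volume_Icc]
      congr 1; ring
    · rw [Set.indicator_of_notMem hy]
      have : (fun x => (x, y)) ⁻¹' s = ∅ := by
        ext x
        simp only [s, Set.mem_preimage, Set.mem_ofPred_eq, Set.mem_empty_iff_false, iff_false]
        rintro ⟨h, -⟩
        exact hy (abs_le.1 (by linarith))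
      rw [this, measure_empty]
  simp_rw [hslice]
  have hcont : Continuous fun y : ℝ => 2 * (R - |y| / √3) := by fun_prop
  rw [lintegral_indicator measurableSet_Icc, ← ofReal_integral_eq_lintegral_ofReal
    hcont.integrableOn_Icc]
  · congr 1
    rw [integral_Icc_eq_integral_Ioc, ← intervalIntegral.integral_of_le (by linarith),
      ← intervalIntegral.integral_add_adjacent_intervals (b := 0)
        (hcont.intervalIntegrable _ _) (hcont.intervalIntegrable _ _)]
    have e1 : ∫ y in (-m)..0, 2 * (R - |y| / √3) = ∫ y in (0 : ℝ)..m, 2 * (R - |y| / √3) := by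
      have := intervalIntegral.integral_comp_neg (a := 0) (b := m)
        (fun y : ℝ => 2 * (R - |y| / √3))
      simpa using this.symm
    have e2 : ∫ y in (0 : ℝ)..m, 2 * (R - |y| / √3) = ∫ y in (0 : ℝ)..m, (2 * R - 2 / √3 * y) := by
      refine intervalIntegral.integral_congr fun y hy => ?_
      rw [Set.uIcc_of_le hm0.le] at hy
      simp only [abs_of_nonneg hy.1]
      ring
    rw [e1, e2, intervalIntegral.integral_sub (by simp)
      ((by fun_prop : Continuous fun y : ℝ => 2 / √3 * y).intervalIntegrable _ _),
      intervalIntegral.integral_const_mul (2 / √3), integral_id, intervalIntegral.integral_const, hm]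
    simp only [smul_eq_mul]
    field_simp
    nlinarith
  · refine (ae_restrict_mem measurableSet_Icc).mono fun y hy => ?_
    have hy' : 2 * |y| ≤ √3 * R := by have := abs_le.2 hy; linarith
    have : |y| / √3 ≤ R := by rw [div_le_iff₀ h3]; nlinarith [abs_nonneg y]
    simp only [Pi.zero_apply]
    linarith

theorem IsRegularHexagon.exists_linearIsometryEquiv {v : Fin 6 → EuclideanSpace ℝ (Fin 2)}
    (hv : IsRegularHexagon v) :
    ∃ (o : EuclideanSpace ℝ (Fin 2)) (R : ℝ) (Ψ : ℂ ≃ₗᵢ[ℝ] EuclideanSpace ℝ (Fin 2)),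
      0 < R ∧ ∀ k, v k = o + Ψ (R • unitHexagonVertex k) := by
  obtain ⟨o, R, θ, hR, hv⟩ := hv
  refine ⟨o, R, (rotation (Circle.exp θ)).trans Complex.orthonormalBasisOneI.repr, hR,
    fun k => ?_⟩
  rw [hv k, map_smul]
  congr 2
  have hk : unitHexagonVertex k =
      ⟨Real.cos ((k : ℕ) * (Real.pi / 3)), Real.sin ((k : ℕ) * (Real.pi / 3))⟩ := by
    have c2 : Real.cos (2 * (Real.pi / 3)) = -1 / 2 := by
      rw [Real.cos_two_mul, Real.cos_pi_div_three]; norm_num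
    have s2 : Real.sin (2 * (Real.pi / 3)) = √3 / 2 := by
      rw [Real.sin_two_mul, Real.cos_pi_div_three, Real.sin_pi_div_three]; ring
    have c3 : Real.cos (3 * (Real.pi / 3)) = -1 := by
      rw [mul_div_cancel₀ _ (by norm_num : (3 : ℝ) ≠ 0), Real.cos_pi]
    have s3 : Real.sin (3 * (Real.pi / 3)) = 0 := by
      rw [mul_div_cancel₀ _ (by norm_num : (3 : ℝ) ≠ 0), Real.sin_pi]
    have e4 : 4 * (Real.pi / 3) = Real.pi / 3 + Real.pi := by ring
    have e5 : 5 * (Real.pi / 3) = 2 * Real.pi - Real.pi / 3 := by ring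
    have c4 : Real.cos (4 * (Real.pi / 3)) = -1 / 2 := by
      rw [e4, Real.cos_add_pi, Real.cos_pi_div_three]; norm_num
    have s4 : Real.sin (4 * (Real.pi / 3)) = -(√3 / 2) := by
      rw [e4, Real.sin_add_pi, Real.sin_pi_div_three]
    have c5 : Real.cos (5 * (Real.pi / 3)) = 1 / 2 := by
      rw [e5, Real.cos_two_pi_sub, Real.cos_pi_div_three]
    have s5 : Real.sin (5 * (Real.pi / 3)) = -(√3 / 2) := by
      rw [e5, Real.sin_two_pi_sub, Real.sin_pi_div_three]
    fin_cases k <;> simp [unitHexagonVertex, c2, s2, c3, s3, c4, s4, c5, s5]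
  ext i
  fin_cases i <;>
    simp [hk, rotation_apply, Complex.orthonormalBasisOneI_repr_apply, Complex.exp_re,
      Complex.exp_im, Real.cos_add, Real.sin_add, Complex.mul_re, Complex.mul_im]
  ring

theorem convexHull_range_eq_image_hexagon {v : Fin 6 → EuclideanSpace ℝ (Fin 2)}
    {o : EuclideanSpace ℝ (Fin 2)} {R : ℝ} {Ψ : ℂ ≃ₗᵢ[ℝ] EuclideanSpace ℝ (Fin 2)} (hR : 0 < R)
    (hv : ∀ k, v k = o + Ψ (R • unitHexagonVertex k)) :
    convexHull ℝ (Set.range v) = o +ᵥ (Ψ '' hexagon R) := by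
  have : Set.range v = o +ᵥ (Ψ '' Set.range fun k => R • unitHexagonVertex k) := by
    rw [← Set.range_comp, ← Set.image_vadd, ← Set.range_comp]
    congr 1
    ext1 k
    exact hv k
  rw [this, convexHull_vadd, ← convexHull_range_unitHexagonVertex hR]
  congr 1
  exact (Ψ.toLinearEquiv.toLinearMap.image_convexHull _).symm

theorem volume_convexHull_range_eq {v : Fin 6 → EuclideanSpace ℝ (Fin 2)}
    {o : EuclideanSpace ℝ (Fin 2)} {R : ℝ} {Ψ : ℂ ≃ₗᵢ[ℝ] EuclideanSpace ℝ (Fin 2)} (hR : 0 < R)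
    (hv : ∀ k, v k = o + Ψ (R • unitHexagonVertex k)) :
    volume (convexHull ℝ (Set.range v)) = ENNReal.ofReal (3 * √3 / 2 * R ^ 2) := by
  rw [convexHull_range_eq_image_hexagon hR hv, measure_vadd, ← volume_hexagon hR]
  exact Ψ.toMeasurableEquiv.image_eq_preimage_symm (hexagon R) ▸
    (Ψ.symm.measurePreserving.measure_preimage_equiv (f := Ψ.symm.toMeasurableEquiv) (hexagon R))

/-- The disk touches two opposite sides, √3 R apart, so its diameter is at least that width. Neither
the other four sides nor the position of the centre `c` matter. -/
theorem IsCircumscribedAbout.apothem_le {v : Fin 6 → EuclideanSpace ℝ (Fin 2)}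
    {o : EuclideanSpace ℝ (Fin 2)} {R : ℝ} {Ψ : ℂ ≃ₗᵢ[ℝ] EuclideanSpace ℝ (Fin 2)}
    (hv : ∀ k, v k = o + Ψ (R • unitHexagonVertex k)) {c : EuclideanSpace ℝ (Fin 2)} {r : ℝ}
    (h : IsCircumscribedAbout v (Metric.closedBall c r)) : √3 / 2 * R ≤ r := by
  let f : EuclideanSpace ℝ (Fin 2) → ℝ := fun x => (Ψ.symm (x - o)).im
  have hfv : ∀ k, f (v k) = R * (unitHexagonVertex k).im := fun k => by simp [f, hv k]
  have hseg : ∀ (k : Fin 6) (a : ℝ), f (v k) = a → f (v (k + 1)) = a →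
      ∃ x, f x = a ∧ ‖x - c‖ ≤ r := by
    intro k a h1 h2
    obtain ⟨_, ⟨s, t, hs, ht, hst, rfl⟩, hx⟩ := h.2 k
    refine ⟨_, ?_, mem_closedBall_iff_norm.1 hx⟩
    have : s • v k + t • v (k + 1) - o = s • (v k - o) + t • (v (k + 1) - o) := by
      have ho : o = (s + t) • o := by rw [hst, one_smul]
      nth_rewrite 1 [ho]
      module
    simp only [f] at h1 h2 ⊢
    rw [this, map_add, map_smul, map_smul, Complex.add_im, Complex.smul_im, Complex.smul_im, h1,
      h2, smul_eq_mul, smul_eq_mul, ← add_mul, hst, one_mul]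
  have hlip : ∀ x, |f x - f c| ≤ ‖x - c‖ := by
    intro x
    have : f x - f c = (Ψ.symm (x - c)).im := by
      simp only [f]
      rw [← Complex.sub_im, ← map_sub]
      congr 2
      abel
    rw [this, ← Ψ.symm.norm_map (x - c)]
    exact Complex.abs_im_le_norm _
  obtain ⟨x, hx, hxr⟩ := hseg 1 (R * (√3 / 2))
    (by rw [hfv]; simp [unitHexagonVertex]) (by rw [hfv]; simp [unitHexagonVertex])
  obtain ⟨y, hy, hyr⟩ := hseg 4 (R * -(√3 / 2))
    (by rw [hfv]; simp [unitHexagonVertex]) (by rw [hfv]; simp [unitHexagonVertex])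
  have h1 := (abs_le.1 ((hlip x).trans hxr)).2
  have h2 := (abs_le.1 ((hlip y).trans hyr)).1
  rw [hx] at h1
  rw [hy] at h2
  linarith

/-! ### The hexagonal lattice packing and its density. -/

/-- A nonzero functional is an open map, so it sends the interior into the open interval. The
strictness is what lets adjacent tiles touch. -/
theorem abs_sub_lt_of_mem_interior {E : Type*} [NormedAddCommGroup E] [NormedSpace ℝ E]
    {K : Set E} {ℓ : E →L[ℝ] ℝ} (hℓ : ℓ ≠ 0) {a b : ℝ} (h : ∀ x ∈ K, |ℓ x - b| ≤ a) {z w : E}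
    (hz : z ∈ interior K) (hw : w ∈ interior K) : |ℓ (z - w)| < 2 * a := by
  have key : ∀ x ∈ interior K, ℓ x ∈ Set.Ioo (b - a) (b + a) := by
    intro x hx
    have hopen : IsOpen (ℓ '' interior K) := ℓ.isOpenMap_of_ne_zero hℓ _ isOpen_interior
    rw [← interior_Icc]
    refine interior_maximal ?_ hopen ⟨x, hx, rfl⟩
    rintro _ ⟨y, hy, rfl⟩
    have := abs_le.1 (h y (interior_subset hy))
    exact ⟨by linarith, by linarith⟩
  have h1 := key z hz
  have h2 := key w hw
  rw [map_sub, abs_lt]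
  constructor <;> linarith [h1.1, h1.2, h2.1, h2.2]

theorem isPacking_translates {K : Set (EuclideanSpace ℝ (Fin 2))}
    {L : Submodule ℤ (EuclideanSpace ℝ (Fin 2))}
    (hdis : ∀ x ∈ L, ∀ z ∈ interior K, ∀ w ∈ interior K, z - w = x → x = 0) :
    IsPacking K {A | ∃ x ∈ L, A = x +ᵥ K} := by
  constructor
  · rintro _ ⟨x, -, rfl⟩
    exact ⟨IsometryEquiv.constVAdd x, rfl⟩
  · rintro _ ⟨x, hx, rfl⟩ _ ⟨y, hy, rfl⟩ hne
    refine Set.disjoint_left.2 fun z hz hz' => hne ?_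
    rw [interior_vadd] at hz hz'
    obtain ⟨p, hp, rfl⟩ := hz
    obtain ⟨q, hq, hpq⟩ := hz'
    simp only [vadd_eq_add] at hpq
    have h0 : p - q = y - x := by
      rw [sub_eq_sub_iff_add_eq_add, add_comm p, ← hpq]
    have := hdis (y - x) (L.sub_mem hy hx) p hp q hq h0
    rw [sub_eq_zero.1 this]

/-- Fundamental cells at lattice points of norm at most R - M₂ cover the ball of radius R - (M₁ +
M₂), while the translates of `K` at those points lie in the ball of radius R. This bounds the number
of full copies from below. -/
theorem le_familyDensity_translates {K : Set (EuclideanSpace ℝ (Fin 2))}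
    (hK : Bornology.IsBounded K) (hKi : (interior K).Nonempty)
    (b : Module.Basis (Fin 2) ℝ (EuclideanSpace ℝ (Fin 2)))
    (hdis : ∀ x ∈ Submodule.span ℤ (Set.range b), ∀ z ∈ interior K, ∀ w ∈ interior K,
      z - w = x → x = 0) :
    volume K / volume (ZSpan.fundamentalDomain b) ≤
      familyDensity {A | ∃ x ∈ Submodule.span ℤ (Set.range b), A = x +ᵥ K} := by
  classical
  set L := Submodule.span ℤ (Set.range b)
  set Q := ZSpan.fundamentalDomain b
  set F := {A | ∃ x ∈ L, A = x +ᵥ K}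
  obtain ⟨M₁, hM₁⟩ := (ZSpan.fundamentalDomain_isBounded b).subset_closedBall 0
  obtain ⟨M₂, hM₂⟩ := hK.subset_closedBall 0
  have hQ0 : volume Q ≠ 0 := ZSpan.measure_fundamentalDomain_ne_zero b
  have hQt : volume Q ≠ ∞ := (ZSpan.fundamentalDomain_isBounded b).measure_lt_top.ne
  -- The family is a set of sets, so different lattice vectors must be shown to give different
  -- translates.
  have hinj : Function.Injective fun x : L =>
      (⟨(x : EuclideanSpace ℝ (Fin 2)) +ᵥ K, x, x.2, rfl⟩ : F) := by
    intro x y hxy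
    have hxy' : (x : EuclideanSpace ℝ (Fin 2)) +ᵥ K = (y : EuclideanSpace ℝ (Fin 2)) +ᵥ K :=
      congrArg Subtype.val hxy
    obtain ⟨z, hz⟩ := hKi
    have h1 : (x : EuclideanSpace ℝ (Fin 2)) + z ∈
        (y : EuclideanSpace ℝ (Fin 2)) +ᵥ interior K := by
      rw [← interior_vadd, ← hxy', interior_vadd]
      exact ⟨z, hz, rfl⟩
    obtain ⟨w, hw, hwz⟩ := h1
    simp only [vadd_eq_add] at hwz
    have := hdis (x - y) (L.sub_mem x.2 y.2) w hw z hz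
      (by rw [sub_eq_sub_iff_add_eq_add, add_comm w, hwz])
    exact Subtype.ext (sub_eq_zero.1 this)
  have hbound : ∀ R : ℝ, volume K / volume Q *
      volume (Metric.closedBall (0 : EuclideanSpace ℝ (Fin 2)) (R + -(M₁ + M₂))) ≤
      ∑' A : F, volume ((A : Set (EuclideanSpace ℝ (Fin 2))) ∩ Metric.closedBall 0 R) := by
    intro R
    let χ : L → ℝ≥0∞ := fun x => if ‖(x : EuclideanSpace ℝ (Fin 2))‖ ≤ R - M₂ then 1 else 0
    have hcov : volume (Metric.closedBall (0 : EuclideanSpace ℝ (Fin 2)) (R + -(M₁ + M₂))) ≤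
        (∑' x, χ x) * volume Q := by
      calc _ ≤ volume (⋃ x : L, if ‖(x : EuclideanSpace ℝ (Fin 2))‖ ≤ R - M₂ then
              (x : EuclideanSpace ℝ (Fin 2)) +ᵥ Q else ∅) := by
            refine measure_mono fun y hy => ?_
            rw [mem_closedBall_zero_iff] at hy
            refine Set.mem_iUnion.2 ⟨ZSpan.floor b y, ?_⟩
            have hf : ‖ZSpan.fract b y‖ ≤ M₁ :=
              mem_closedBall_zero_iff.1 (hM₁ (ZSpan.fract_mem_fundamentalDomain b y))
            have hfl : (ZSpan.floor b y : EuclideanSpace ℝ (Fin 2)) = y - ZSpan.fract b y := by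
              rw [ZSpan.fract_apply, sub_sub_cancel]
            have hn : ‖(ZSpan.floor b y : EuclideanSpace ℝ (Fin 2))‖ ≤ R - M₂ := by
              rw [hfl]
              linarith [norm_sub_le y (ZSpan.fract b y)]
            rw [if_pos hn]
            refine ⟨ZSpan.fract b y, ZSpan.fract_mem_fundamentalDomain b y, ?_⟩
            simp only [vadd_eq_add]
            rw [hfl, sub_add_cancel]
        _ ≤ ∑' x : L, volume (if ‖(x : EuclideanSpace ℝ (Fin 2))‖ ≤ R - M₂ then
              (x : EuclideanSpace ℝ (Fin 2)) +ᵥ Q else ∅) := measure_iUnion_le _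
        _ = ∑' x, χ x * volume Q := by
            refine tsum_congr fun x => ?_
            by_cases h : ‖(x : EuclideanSpace ℝ (Fin 2))‖ ≤ R - M₂
            · simp only [χ, if_pos h, measure_vadd, one_mul]
            · simp only [χ, if_neg h, measure_empty, zero_mul]
        _ = _ := ENNReal.tsum_mul_right
    calc _ ≤ volume K / volume Q * ((∑' x, χ x) * volume Q) := by gcongr
      _ = ∑' x, χ x * volume K := by
          rw [mul_left_comm, ENNReal.div_mul_cancel hQ0 hQt, ENNReal.tsum_mul_right]
      _ ≤ ∑' x : L, volume (((x : EuclideanSpace ℝ (Fin 2)) +ᵥ K) ∩ Metric.closedBall 0 R) := by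
          refine ENNReal.tsum_le_tsum fun x => ?_
          by_cases h : ‖(x : EuclideanSpace ℝ (Fin 2))‖ ≤ R - M₂
          · simp only [χ, if_pos h, one_mul]
            rw [Set.inter_eq_left.2, measure_vadd]
            rintro _ ⟨y, hy, rfl⟩
            have := mem_closedBall_zero_iff.1 (hM₂ hy)
            rw [mem_closedBall_zero_iff]
            simp only [vadd_eq_add]
            linarith [norm_add_le (x : EuclideanSpace ℝ (Fin 2)) y]
          · simp only [χ, if_neg h, zero_mul, zero_le]
      _ ≤ _ := ENNReal.tsum_comp_le_tsum_of_injective hinj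
          fun A : F => volume ((A : Set (EuclideanSpace ℝ (Fin 2))) ∩ Metric.closedBall 0 R)
  have hlim : Tendsto (fun R : ℝ => volume K / volume Q *
      (volume (Metric.closedBall (0 : EuclideanSpace ℝ (Fin 2)) (R + -(M₁ + M₂))) /
      volume (Metric.closedBall (0 : EuclideanSpace ℝ (Fin 2)) R))) atTop
      (nhds (volume K / volume Q * 1)) :=
    ENNReal.Tendsto.const_mul (tendsto_volume_closedBall_div_volume_closedBall _)
      (Or.inl one_ne_zero)
  rw [mul_one] at hlim
  rw [familyDensity, ← hlim.limsup_eq]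
  refine limsup_le_limsup (Eventually.of_forall fun R => ?_)
  simp only [← mul_div_assoc]
  gcongr
  exact hbound R

/-- A basis of the lattice of centres of the tiling by translates of the regular hexagon with
circumradius `R`. -/
theorem exists_hexagonal_basis (Ψ : ℂ ≃ₗᵢ[ℝ] EuclideanSpace ℝ (Fin 2)) {R : ℝ} (hR : 0 < R) :
    ∃ b : Module.Basis (Fin 2) ℝ (EuclideanSpace ℝ (Fin 2)),
      b 0 = Ψ ⟨3 / 2 * R, √3 / 2 * R⟩ ∧ b 1 = Ψ ⟨0, √3 * R⟩ ∧
      volume (ZSpan.fundamentalDomain b) = ENNReal.ofReal (3 * √3 / 2 * R ^ 2) := by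
  have h3 : 0 < √3 := by positivity
  set e : Fin 2 → EuclideanSpace ℝ (Fin 2) :=
    ![Ψ ⟨3 / 2 * R, √3 / 2 * R⟩, Ψ ⟨0, √3 * R⟩] with he
  have hli : LinearIndependent ℝ e := by
    rw [LinearIndependent.pair_iff]
    intro s t hst
    rw [← map_smul, ← map_smul, ← map_add, LinearIsometryEquiv.map_eq_zero_iff] at hst
    have h1 := congrArg Complex.re hst
    have h2 := congrArg Complex.im hst
    simp only [Complex.add_re, Complex.smul_re, Complex.add_im, Complex.smul_im, smul_eq_mul,
      mul_zero, add_zero, Complex.zero_re, Complex.zero_im] at h1 h2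
    have hs : s = 0 := by
      rcases mul_eq_zero.1 h1 with h | h
      · exact h
      · exact absurd h (by positivity)
    subst hs
    rw [zero_mul, zero_add] at h2
    exact ⟨rfl, (mul_eq_zero.1 h2).resolve_right (by positivity)⟩
  let b := basisOfLinearIndependentOfCardEqFinrank hli (by simp)
  have hb : ⇑b = e := coe_basisOfLinearIndependentOfCardEqFinrank _ _
  refine ⟨b, by rw [hb]; rfl, by rw [hb]; rfl, ?_⟩
  -- The area is the determinant of `b` relative to an orthonormal basis, whose fundamental domain
  -- has volume 1.
  let b₀ := Complex.orthonormalBasisOneI.map Ψ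
  have hvol : volume (ZSpan.fundamentalDomain b₀.toBasis) = 1 := by
    rw [measure_congr (ZSpan.fundamentalDomain_ae_parallelepiped b₀.toBasis volume),
      OrthonormalBasis.coe_toBasis, OrthonormalBasis.volume_parallelepiped]
  have hdet : b₀.toBasis.det b = 3 * √3 / 2 * R ^ 2 := by
    have hrepr : ∀ z : ℂ, b₀.repr (Ψ z) = !₂[z.re, z.im] := by
      intro z
      change Complex.orthonormalBasisOneI.repr (Ψ.symm (Ψ z)) = _
      rw [Ψ.symm_apply_apply]
      ext i
      fin_cases i <;> simp [Complex.orthonormalBasisOneI_repr_apply]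
    rw [Module.Basis.det_apply, Matrix.det_fin_two]
    simp only [Module.Basis.toMatrix_apply, OrthonormalBasis.coe_toBasis_repr_apply, hb, he,
      Matrix.cons_val_zero, Matrix.cons_val_one, hrepr]
    ring
  rw [ZSpan.measure_fundamentalDomain b volume b₀.toBasis, hvol, hdet, mul_one,
    abs_of_nonneg (by positivity)]

/-- Each pair of opposite sides bounds a slab of a functional that takes values in ℤ · √3 R on the
lattice. Two interior points differ by less than 2√3 R under it, so the integer is -1, 0 or 1. The
three resulting constraints force both coordinates to vanish. -/
theorem hexagonal_lattice_disjoint_interiors {Ψ : ℂ ≃ₗᵢ[ℝ] EuclideanSpace ℝ (Fin 2)} {R : ℝ}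
    (hR : 0 < R) {b : Module.Basis (Fin 2) ℝ (EuclideanSpace ℝ (Fin 2))}
    (hb₀ : b 0 = Ψ ⟨3 / 2 * R, √3 / 2 * R⟩) (hb₁ : b 1 = Ψ ⟨0, √3 * R⟩)
    {o : EuclideanSpace ℝ (Fin 2)} {K : Set (EuclideanSpace ℝ (Fin 2))}
    (hK : K ⊆ o +ᵥ (Ψ '' hexagon R)) :
    ∀ x ∈ Submodule.span ℤ (Set.range b), ∀ z ∈ interior K, ∀ w ∈ interior K,
      z - w = x → x = 0 := by
  rintro x hx z hz w hw rfl
  have hm : 0 < √3 * R := by positivity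
  have h33 := sqrt_three_mul_self
  obtain ⟨m, hmx⟩ := (Submodule.mem_span_range_iff_exists_fun ℤ).1 hx
  rw [Fin.sum_univ_two, hb₀, hb₁] at hmx
  have hzw : Ψ.symm (z - w) =
      (m 0 : ℝ) • (⟨3 / 2 * R, √3 / 2 * R⟩ : ℂ) + (m 1 : ℝ) • (⟨0, √3 * R⟩ : ℂ) := by
    rw [← hmx, map_add, map_zsmul, map_zsmul, Ψ.symm_apply_apply, Ψ.symm_apply_apply,
      Int.cast_smul_eq_zsmul, Int.cast_smul_eq_zsmul]
  have key : ∀ (p q : ℝ) (k : ℤ), (p ≠ 0 ∨ q ≠ 0) →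
      (∀ y ∈ hexagon R, |p * y.re + q * y.im| ≤ √3 * R) →
      p * (Ψ.symm (z - w)).re + q * (Ψ.symm (z - w)).im = k * (√3 * R) → |k| < 2 := by
    intro p q k hpq hbd hk
    let ℓ₀ : ℂ →L[ℝ] ℝ := p • Complex.reCLM + q • Complex.imCLM
    let ℓ : EuclideanSpace ℝ (Fin 2) →L[ℝ] ℝ :=
      ℓ₀.comp Ψ.symm.toContinuousLinearEquiv.toContinuousLinearMap
    have hℓ : ∀ y, ℓ y = p * (Ψ.symm y).re + q * (Ψ.symm y).im := fun y => rfl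
    have hne : ℓ ≠ 0 := by
      intro h0
      have h1 := congrArg (fun f => f (Ψ 1)) h0
      have h2 := congrArg (fun f => f (Ψ Complex.I)) h0
      simp [hℓ] at h1 h2
      simp [h1, h2] at hpq
    have hb : ∀ y ∈ K, |ℓ y - ℓ o| ≤ √3 * R := by
      intro y hy
      obtain ⟨_, ⟨u, hu, rfl⟩, rfl⟩ := hK hy
      simp only [vadd_eq_add]
      rw [← map_sub, add_sub_cancel_left, hℓ, Ψ.symm_apply_apply]
      exact hbd u hu
    have h := abs_sub_lt_of_mem_interior hne hb hz hw
    rw [hℓ, hk, abs_mul, abs_of_pos hm] at h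
    have h2 : |(k : ℝ)| < 2 := lt_of_mul_lt_mul_right h hm.le
    exact_mod_cast h2
  have hab : ∀ y ∈ hexagon R, |√3 * y.re| + |y.im| ≤ √3 * R := by
    intro y hy
    rw [abs_mul, abs_of_pos (by positivity : (0 : ℝ) < √3)]
    exact hy.2
  have k1 : |2 * m 0 + m 1| < 2 := by
    refine key (√3) 1 _ (Or.inr one_ne_zero) (fun y hy => ?_) ?_
    · rw [one_mul]
      exact (abs_add_le _ _).trans (hab y hy)
    · rw [hzw]; simp; ring
  have k2 : |m 0 - m 1| < 2 := by
    refine key (√3) (-1) _ (Or.inr (by norm_num)) (fun y hy => ?_) ?_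
    · rw [neg_one_mul, ← sub_eq_add_neg]
      exact (abs_sub _ _).trans (hab y hy)
    · rw [hzw]; simp; ring
  have k3 : |m 0 + 2 * m 1| < 2 := by
    refine key 0 2 _ (Or.inr two_ne_zero) (fun y hy => ?_) ?_
    · rw [zero_mul, zero_add, abs_mul, abs_two]
      exact hy.1
    · rw [hzw]; simp; ring
  rw [abs_lt] at k1 k2 k3
  have h0 : m 0 = 0 := by omega
  have h1 : m 1 = 0 := by omega
  rw [← hmx, h0, h1, zero_smul, zero_smul, add_zero]

/-! ### Comparison of the three densities and conclusion. -/

theorem latticePackingDensity_le_translativePackingDensity {n : ℕ}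
    (K : Set (EuclideanSpace ℝ (Fin n))) :
    latticePackingDensity K ≤ translativePackingDensity K := by
  refine sSup_le_sSup ?_
  rintro d ⟨F, hF, ⟨L, _, _, rfl⟩, hd⟩
  refine ⟨_, hF, ?_, hd⟩
  rintro A ⟨x, -, hA⟩
  exact ⟨x, hA⟩

theorem translativePackingDensity_le_packingDensity {n : ℕ}
    (K : Set (EuclideanSpace ℝ (Fin n))) :
    translativePackingDensity K ≤ packingDensity K :=
  sSup_le_sSup fun _ ⟨F, hF, _, hd⟩ => ⟨F, hF, hd⟩

theorem proposition4
    (c : EuclideanSpace ℝ (Fin 2)) (r : ℝ) (hr : 0 < r)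
    (v : Fin 6 → EuclideanSpace ℝ (Fin 2)) (hv : IsRegularHexagon v)
    (hcirc : IsCircumscribedAbout v (Metric.closedBall c r))
    (K : Set (EuclideanSpace ℝ (Fin 2))) (hK : IsConvexBody K)
    (hs : SandwichedBetween K (Metric.closedBall c r) (convexHull ℝ (Set.range v))) :
    packingDensity K = volume K / volume (convexHull ℝ (Set.range v)) ∧
      packingDensity K = translativePackingDensity K ∧
      translativePackingDensity K = latticePackingDensity K := by
  -- In the reversed order of the sandwich, C ⊆ H supplies both inclusions.
  obtain ⟨hCK, hKH⟩ : Metric.closedBall c r ⊆ K ∧ K ⊆ convexHull ℝ (Set.range v) := by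
    rcases hs with hs | ⟨h1, h2⟩
    · exact hs
    · exact ⟨hcirc.1.trans h1, h2.trans hcirc.1⟩
  obtain ⟨o, R, Ψ, hR, hvΨ⟩ := hv.exists_linearIsometryEquiv
  have hbdd : Bornology.IsBounded K := hK.isCompact.isBounded
  rw [volume_convexHull_range_eq hR hvΨ]
  -- The disk is shrunk to the apothem of the hexagon, so that ρ is exactly R; only apothem ≤ r is
  -- needed.
  have hup : packingDensity K ≤ volume K / ENNReal.ofReal (3 * √3 / 2 * R ^ 2) :=
    packingDensity_le (c := c) (r := √3 / 2 * R) hR (by ring)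
      ((Metric.closedBall_subset_closedBall (hcirc.apothem_le hvΨ)).trans hCK) hbdd
  obtain ⟨b, hb₀, hb₁, hvol⟩ := exists_hexagonal_basis Ψ hR
  rw [convexHull_range_eq_image_hexagon hR hvΨ] at hKH
  have hdis := hexagonal_lattice_disjoint_interiors hR hb₀ hb₁ hKH
  have hlow : volume K / ENNReal.ofReal (3 * √3 / 2 * R ^ 2) ≤ latticePackingDensity K := by
    rw [← hvol]
    refine (le_familyDensity_translates hbdd hK.interior_nonempty b hdis).trans (le_sSup ?_)
    exact ⟨_, isPacking_translates hdis,
      ⟨Submodule.span ℤ (Set.range b), inferInstance, inferInstance, rfl⟩, rfl⟩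
  have h1 := latticePackingDensity_le_translativePackingDensity K
  have h2 := translativePackingDensity_le_packingDensity K
  exact ⟨le_antisymm hup (hlow.trans (h1.trans h2)),
    le_antisymm (hup.trans (hlow.trans h1)) h2,
    le_antisymm (h2.trans (hup.trans hlow)) h1⟩
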